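/- Let $\Omega\subset\mathbb{R}^3$ be a bounded open set with Lipschitz boundary, i.e. near each boundary point, in suitable orthonormal coordinates, $\Omega$ is the region above the graph of a Lipschitz function; let $n$ be its outward unit normal, which exists almost everywhere on $\partial\Omega$. For a tensor field $\sigma=(\sigma_{ij})$ of class $H^1(\Omega)$ write $(\mathrm{Div}\,\sigma)_j=\sum_i\partial_i\sigma_{ij}$ (weak derivatives) and $(\sigma\cdot n)_i=\sum_j\sigma_{ij}n_j$, where the boundary values of $\sigma$ are taken in the sense of traces. (1) Let $\sigma\in H^1(\Omega;\mathbb{R}^{3\times3})$ be symmetric with $\mathrm{Div}\,\sigma=0$ in $\Omega$ and $\sigma\cdot n=0$ almost everywhere on $\partial\Omega$. If $\sigma_{11}=\sigma_{22}=\sigma_{33}=0$ almost everywhere in $\Omega$, then $\sigma=0$ almost everywhere in $\Omega$. (2) Consequently, in a homogeneous isotropic body the three diagonal (normal) strain components determine the whole elastic strain tensor. Precisely, let $E>0$ and $-1<\nu<\tfrac12$ be Young's modulus and Poisson's ratio, and let $C_{ijkl}=\lambda\,\delta_{ij}\delta_{kl}+\mu(\delta_{ik}\delta_{jl}+\delta_{il}\delta_{jk})$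 with $\lambda=\frac{E\nu}{(1+\nu)(1-2\nu)}$ and $\mu=\frac{E}{2(1+\nu)}$. Let $\epsilon,\epsilon'\in H^1(\Omega;\mathbb{R}^{3\times3})$ be symmetric strain fields whose stresses $\sigma=C:\epsilon$ and $\sigma'=C:\epsilon'$, where $(C:\epsilon)_{ij}=\sum_{k,l}C_{ijkl}\epsilon_{kl}$, both have zero divergence in $\Omega$ and zero traction ($\sigma\cdot n=\sigma'\cdot n=0$ almost everywhere) on $\partial\Omega$. If $\epsilon_{ii}=\epsilon'_{ii}$ almost everywhere in $\Omega$ for $i=1,2,3$ (no summation), then $\epsilon=\epsilon'$ almost everywhere in $\Omega$. -/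

import Mathlib

open MeasureTheory Filter Topology
open scoped ContDiff InnerProductSpace

noncomputable section

/-- Euclidean three-space. -/
abbrev E3 : Type := EuclideanSpace ℝ (Fin 3)

/-- The classical partial derivative `∂ᵢ f`. -/
def partialDeriv (i : Fin 3) (f : E3 → ℝ) (x : E3) : ℝ :=
  fderiv ℝ f x (EuclideanSpace.single i 1)

/-- `Ω` has a Lipschitz boundary: near each boundary point, and in suitable orthonormal
coordinates, `Ω` is the set of points strictly above the graph of a Lipschitz function. -/
def HasLipschitzBoundary (Ω : Set E3) : Prop :=
  ∀ p ∈ frontier Ω, ∃ (A : E3 ≃ₗᵢ[ℝ] E3) (K : NNReal) (g : EuclideanSpace ℝ (Fin 2) → ℝ) (r : ℝ),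
    LipschitzWith K g ∧ 0 < r ∧
      ∀ y ∈ Metric.ball p r, (y ∈ Ω ↔ g (!₂[A y 0, A y 1]) < A y 2)

/-- The surface measure of `∂Ω` (two-dimensional Hausdorff measure, up to normalization). -/
def surfaceMeasure (Ω : Set E3) : Measure E3 :=
  (Measure.hausdorffMeasure 2).restrict (frontier Ω)

/-- `n` is the outward unit normal of `Ω` at the boundary point `x`: the boundary has a tangent
plane at `x` with unit normal `n`, the set `Ω` lying on the side opposite to `n`. If `Ω` is locally
the region above the graph of `g`, this vector exists wherever `g` is differentiable, and it is
then the normalization of `(∇g, -1)`. -/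
def IsOutwardUnitNormal (Ω : Set E3) (x n : E3) : Prop :=
  ‖n‖ = 1 ∧ ∀ ε > 0, ∀ᶠ y in 𝓝 x,
    (ε * ‖y - x‖ < ⟪y - x, n⟫_ℝ → y ∉ Ω) ∧ (⟪y - x, n⟫_ℝ < -(ε * ‖y - x‖) → y ∈ Ω)

/-- `v ∈ L²(Ω)` is the weak partial derivative `∂ᵢ u` on `Ω`. -/
def IsWeakPartial (Ω : Set E3) (i : Fin 3) (u v : E3 → ℝ) : Prop :=
  MemLp v 2 (volume.restrict Ω) ∧
    ∀ φ : E3 → ℝ, ContDiff ℝ ∞ φ → HasCompactSupport φ → tsupport φ ⊆ Ω →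
      ∫ x in Ω, u x * partialDeriv i φ x = -∫ x in Ω, v x * φ x

/-- `u ∈ H¹(Ω)`. -/
def MemH1 (Ω : Set E3) (u : E3 → ℝ) : Prop :=
  MemLp u 2 (volume.restrict Ω) ∧ ∀ i, ∃ v, IsWeakPartial Ω i u v

/-- `T ∈ L²(∂Ω)` is the boundary trace of `u ∈ H¹(Ω)`: smooth functions `w k` on `ℝ³` converge to
`u` in `H¹(Ω)` while their restrictions to the boundary converge to `T` in `L²(∂Ω)`. -/
def IsTrace (Ω : Set E3) (u T : E3 → ℝ) : Prop :=
  MemLp T 2 (surfaceMeasure Ω) ∧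
    ∃ (Du : Fin 3 → E3 → ℝ) (w : ℕ → E3 → ℝ),
      (∀ i, IsWeakPartial Ω i u (Du i)) ∧
      (∀ k, ContDiff ℝ ∞ (w k)) ∧
      Tendsto (fun k => eLpNorm (fun x => w k x - u x) 2 (volume.restrict Ω)) atTop (𝓝 0) ∧
      (∀ i, Tendsto (fun k => eLpNorm (fun x => partialDeriv i (w k) x - Du i x) 2
        (volume.restrict Ω)) atTop (𝓝 0)) ∧
      Tendsto (fun k => eLpNorm (fun x => w k x - T x) 2 (surfaceMeasure Ω)) atTop (𝓝 0)

/-- `Div σ = 0` in `Ω`, where `(Div σ)ⱼ = ∑ᵢ ∂ᵢ σᵢⱼ` with weak partial derivatives. -/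
def DivEqZero (Ω : Set E3) (σ : E3 → Matrix (Fin 3) (Fin 3) ℝ) : Prop :=
  ∃ D : Fin 3 → Fin 3 → E3 → ℝ,
    (∀ i j, IsWeakPartial Ω i (fun x => σ x i j) (D i j)) ∧
      ∀ᵐ x ∂(volume.restrict Ω), ∀ j, ∑ i, D i j x = 0

/-- `σ · n = 0` on `∂Ω`: the trace `T` of `σ` annihilates the outward unit normal at almost every
boundary point. -/
def TractionEqZero (Ω : Set E3) (σ : E3 → Matrix (Fin 3) (Fin 3) ℝ) : Prop :=
  ∃ T : E3 → Matrix (Fin 3) (Fin 3) ℝ,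
    (∀ i j, IsTrace Ω (fun x => σ x i j) (fun x => T x i j)) ∧
      ∀ᵐ x ∂(surfaceMeasure Ω), ∀ n : E3, IsOutwardUnitNormal Ω x n →
        ∀ i, ∑ j, T x i j * n j = 0

/-- A symmetric tensor field of class `H¹(Ω)`. -/
structure IsSymmH1 (Ω : Set E3) (σ : E3 → Matrix (Fin 3) (Fin 3) ℝ) : Prop where
  memH1 : ∀ i j, MemH1 Ω (fun x => σ x i j)
  symm : ∀ᵐ x ∂(volume.restrict Ω), (σ x).IsSymm

/-- The stiffness tensor of an isotropic material with Young's modulus `E` and Poisson's ratio `ν`: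
`Cᵢⱼₖₗ = lam δᵢⱼ δₖₗ + μ (δᵢₖ δⱼₗ + δᵢₗ δⱼₖ)`, where `lam` and `μ` are the Lamé constants. -/
def isotropicStiffness (E ν : ℝ) (i j k l : Fin 3) : ℝ :=
  let lam : ℝ := E * ν / ((1 + ν) * (1 - 2 * ν))
  let μ : ℝ := E / (2 * (1 + ν))
  let δ : Matrix (Fin 3) (Fin 3) ℝ := 1
  lam * (δ i j * δ k l) + μ * (δ i k * δ j l + δ i l * δ j k)

/-- Hooke's law `σ = C : ε`, that is `σᵢⱼ = ∑ₖₗ Cᵢⱼₖₗ εₖₗ`, in an isotropic material. -/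
def hookeStress (E ν : ℝ) (ε : Matrix (Fin 3) (Fin 3) ℝ) : Matrix (Fin 3) (Fin 3) ℝ :=
  Matrix.of fun i j => ∑ k, ∑ l, isotropicStiffness E ν i j k l * ε k l

end

/-!
The point is that the extension by zero of an equilibrated stress without traction is
divergence-free in the whole space: `∫_Ω ∑ᵢ σᵢⱼ ∂ᵢφ = 0` for every smooth `φ` on `ℝ³`, without
boundary conditions on `φ` (`DivEqZero.sum_integral_mul_partialDeriv_eq_zero`). Testing with
`cos ⟪x, t⟫` and `sin ⟪x, t⟫` shows that the Fourier transform `S` of `σ` at the frequency `t`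
satisfies `∑ᵢ Sᵢⱼ tᵢ = 0`. If `σ` is symmetric with zero diagonal, so is `S`, and then `S = 0`
whenever all the coordinates of `t` are nonzero (`eq_zero_of_symm_of_diag_eq_zero`). Such `t` are
dense, so that `σ = 0` (`ae_eq_zero_of_integral_cos_sin_eq_zero`).

The whole-space identity is a Gauss–Green formula. By a partition of unity it is enough to test
with `φ` supported in a ball where `Ω` is the epigraph of a Lipschitz function `g`. For smooth fields,
the divergence theorem on the epigraph follows from the volume-preserving shear
`(y, t) ↦ (y, g y + t)`, Fubini, and the fact that derivatives of compactly supported Lipschitz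
functions have mean zero (`integral_fderiv_epigraph`); the boundary term is an integral over the
base with respect to Lebesgue measure, against the conormal `(∇g, -1)`. It passes to fields with
traces because Lebesgue measure on the base is dominated by the surface measure, the projection of
the graph to its base being Lipschitz (`IsGraphChart.exists_map_graph_le`). In particular no area
formula is needed, and the normalization of the surface measure is irrelevant. By Rademacher's theorem
`g` is differentiable almost everywhere, and at such points the normalized conormal is the outward
unit normal, so that the boundary term vanishes (`IsGraphChart.sum_mul_conormal_eq_zero`).

For the statement on strains, Hooke's law reduces to multiplication by `2μ = E / (1 + ν) ≠ 0` on
symmetric matrices with zero diagonal, and the argument above is applied to the difference of the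
two stresses.
-/

/-! ### Passing to the limit in `L²` pairings -/

theorem tendsto_integral_mul_of_tendsto_eLpNorm_sub {α : Type*} [MeasurableSpace α]
    {μ : Measure α} {f h : α → ℝ} {w : ℕ → α → ℝ} (hf : MemLp f 2 μ)
    (hw : ∀ k, AEStronglyMeasurable (w k) μ)
    (hlim : Tendsto (fun k => eLpNorm (fun x => w k x - f x) 2 μ) atTop (𝓝 0))
    (hh : MemLp h 2 μ) :
    Tendsto (fun k => ∫ x, w k x * h x ∂μ) atTop (𝓝 (∫ x, f x * h x ∂μ)) := by
  have hL1 : Tendsto (fun k => eLpNorm (fun x => w k x * h x - f x * h x) 1 μ) atTop (𝓝 0) := by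
    have hmul : Tendsto (fun k => eLpNorm (fun x => w k x - f x) 2 μ * eLpNorm h 2 μ) atTop
        (𝓝 0) := by
      simpa using ENNReal.Tendsto.mul_const hlim (Or.inr hh.2.ne)
    refine tendsto_of_tendsto_of_tendsto_of_le_of_le tendsto_const_nhds hmul
      (fun _ => zero_le) fun k => ?_
    have := eLpNorm_smul_le_mul_eLpNorm (p := 2) (q := 2) (r := 1) hh.1 ((hw k).sub hf.1)
    have heq : (fun x => w k x * h x - f x * h x) = (w k - f) • h := by
      ext x; simp [sub_mul]
    rw [heq]
    exact this
  refine tendsto_integral_of_L1' _ (hf.integrable_mul hh).aestronglyMeasurable ?_ hL1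
  filter_upwards [hlim.eventually (gt_mem_nhds ENNReal.zero_lt_top)] with k hk
  have hsub : MemLp (fun x => w k x - f x) 2 μ := ⟨(hw k).sub hf.1, hk⟩
  have : MemLp (w k) 2 μ := by simpa [Pi.add_def] using hsub.add hf
  exact this.integrable_mul hh

/-! ### The divergence theorem on the epigraph of a Lipschitz function -/

section Epigraph

variable {V : Type*} [NormedAddCommGroup V] [NormedSpace ℝ V] [FiniteDimensional ℝ V]
  [MeasurableSpace V] [BorelSpace V] {μ : Measure V} [μ.IsAddHaarMeasure]

/-- A Lipschitz function with compact support has derivatives of mean zero. -/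
theorem LipschitzWith.integral_lineDeriv_eq_zero {h : V → ℝ} {C : NNReal}
    (hh : LipschitzWith C h) (hc : HasCompactSupport h) (v : V) :
    ∫ y, lineDeriv ℝ h y v ∂μ = 0 := by
  have := LipschitzWith.integral_lineDeriv_mul_eq (μ := μ)
    (LipschitzWith.const (1 : ℝ) : LipschitzWith 0 (fun _ : V => (1 : ℝ))) hh hc (-v)
  simpa [lineDeriv] using this.symm

/-- Vertical shearing `(y, t) ↦ (y, g y + t)` preserves volume. -/
theorem measurePreserving_shear {g : V → ℝ} (hg : Continuous g) :
    MeasurePreserving (fun p : V × ℝ => (p.1, g p.1 + p.2)) (μ.prod volume)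
      (μ.prod volume) :=
  (MeasurePreserving.id μ).skew_product (g := fun y t => g y + t) (by fun_prop)
    (Eventually.of_forall fun y => (measurePreserving_add_left volume (g y)).map_eq)

/-- The divergence theorem on the epigraph of a Lipschitz function `g`, for the constant field
`(e, s)` multiplied by a compactly supported function: the surface integral is written in the
graph coordinate `y`, where `(∇g, -1)` is the non-normalized outward normal. -/
theorem integral_fderiv_epigraph {g : V → ℝ} {K : NNReal} (hg : LipschitzWith K g)
    {F : V × ℝ → ℝ} (hF : ContDiff ℝ 1 F) (hc : HasCompactSupport F) (e : V) (s : ℝ) :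
    ∫ p in {p : V × ℝ | g p.1 < p.2}, fderiv ℝ F p (e, s) ∂(μ.prod volume) =
      ∫ y, F (y, g y) * (fderiv ℝ g y e - s) ∂μ := by
  have hgc : Continuous g := hg.continuous
  let S : V × ℝ ≃ₜ V × ℝ :=
    { toFun := fun p => (p.1, g p.1 + p.2)
      invFun := fun p => (p.1, p.2 - g p.1)
      left_inv := fun p => by simp
      right_inv := fun p => by simp
      continuous_toFun := by fun_prop
      continuous_invFun := by fun_prop }
  have hS : ∀ y t, S (y, t) = (y, g y + t) := fun y t => rfl
  have hSm : MeasurePreserving S (μ.prod volume) (μ.prod volume) := measurePreserving_shear hgc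
  have hd : ∀ v : V × ℝ, Continuous (fun p => fderiv ℝ F p v) := fun v =>
    (hF.continuous_fderiv (by norm_num)).clm_apply continuous_const
  have hdc : ∀ v : V × ℝ, HasCompactSupport (fun p => fderiv ℝ F p v) := fun v =>
    hc.fderiv_apply ℝ v
  have hint : ∀ v : V × ℝ, Integrable (fun p => fderiv ℝ F (S p) v) (μ.prod volume) := fun v =>
    ((hd v).comp S.continuous).integrable_of_hasCompactSupport ((hdc v).comp_homeomorph S)
  have hgm : Measurable fun y => fderiv ℝ g y e := measurable_fderiv_apply_const ℝ g e
  -- By the chain rule, the derivative at `S (y, t)` in the direction `(e, s)` is the derivative of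
  -- `y ↦ F (y, g y + t)` in the direction `e`, whose integral vanishes, plus the vertical part `B`.
  set B : V × ℝ → ℝ := fun p => (s - fderiv ℝ g p.1 e) * fderiv ℝ F (S p) (0, 1) with hB
  have hBint : Integrable B (μ.prod volume) := by
    refine (hint (0, 1)).bdd_mul (c := |s| + K * ‖e‖) ?_ (Eventually.of_forall fun p => ?_)
    · exact (measurable_const.sub (hgm.comp measurable_fst)).aestronglyMeasurable
    · refine (norm_sub_le _ _).trans (add_le_add le_rfl ?_)
      exact ((fderiv ℝ g p.1).le_opNorm e).trans
        (mul_le_mul_of_nonneg_right (norm_fderiv_le_of_lipschitz ℝ hg) (norm_nonneg e))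
  have hset : S ⁻¹' {p : V × ℝ | g p.1 < p.2} = Set.univ ×ˢ Set.Ioi 0 := by
    ext ⟨y, t⟩; simp [hS]
  rw [← hSm.setIntegral_preimage_emb S.measurableEmbedding, hset]
  have hsplit : (fun p => fderiv ℝ F (S p) (e, s)) =
      fun p => (fderiv ℝ F (S p) (e, s) - B p) + B p := by simp
  rw [hsplit]
  have hA : Integrable (fun p => fderiv ℝ F (S p) (e, s) - B p) (μ.prod volume) :=
    (hint (e, s)).sub hBint
  rw [integral_add hA.integrableOn hBint.integrableOn]
  have hA0 : ∫ p in Set.univ ×ˢ Set.Ioi (0 : ℝ), (fderiv ℝ F (S p) (e, s) - B p)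
      ∂(μ.prod volume) = 0 := by
    have hA' : IntegrableOn (fun p => fderiv ℝ F (S p) (e, s) - B p)
      (Set.univ ×ˢ Set.Ioi (0 : ℝ)) (μ.prod volume) := hA.integrableOn
    rw [IntegrableOn, ← Measure.prod_restrict, Measure.restrict_univ] at hA'
    rw [← Measure.prod_restrict, Measure.restrict_univ, integral_prod_symm _ hA']
    refine integral_eq_zero_of_ae (Eventually.of_forall fun t => ?_)
    obtain ⟨C, hC⟩ := hF.lipschitzWith_of_hasCompactSupport hc one_ne_zero
    have hgr : LipschitzWith (max 1 K) (fun y => (y, g y + t)) := by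
      have h2 : LipschitzWith K fun y => g y + t := by
        simpa using hg.add (LipschitzWith.const t)
      exact LipschitzWith.id.prodMk h2
    have hHc : HasCompactSupport (fun y => F (y, g y + t)) := by
      refine HasCompactSupport.intro (hc.isCompact.image continuous_fst) fun y hy => ?_
      by_contra hne
      exact hy ⟨_, subset_tsupport _ hne, rfl⟩
    rw [Pi.zero_apply, ← LipschitzWith.integral_lineDeriv_eq_zero (μ := μ) (hC.comp hgr) hHc e]
    refine integral_congr_ae ?_
    filter_upwards [hg.ae_differentiableAt (μ := μ)] with y hy
    have hgd : HasFDerivAt (fun y => (y, g y + t))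
        ((ContinuousLinearMap.id ℝ V).prod (fderiv ℝ g y)) y :=
      (hasFDerivAt_id y).prodMk (hy.hasFDerivAt.add_const t)
    have hFd : HasFDerivAt F (fderiv ℝ F (y, g y + t)) (y, g y + t) :=
      (hF.differentiable one_ne_zero _).hasFDerivAt
    have := (hFd.comp y hgd).hasLineDerivAt e
    change _ = lineDeriv ℝ (F ∘ fun y => (y, g y + t)) y e
    rw [this.lineDeriv]
    simp only [hB, hS]
    rw [← smul_eq_mul, ← map_smul, ← map_sub]
    simp
  have hB' : IntegrableOn B (Set.univ ×ˢ Set.Ioi (0 : ℝ)) (μ.prod volume) := hBint.integrableOn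
  rw [IntegrableOn, ← Measure.prod_restrict, Measure.restrict_univ] at hB'
  rw [hA0, zero_add, ← Measure.prod_restrict, Measure.restrict_univ, integral_prod _ hB']
  refine integral_congr_ae (Eventually.of_forall fun y => ?_)
  simp only [hB, hS]
  rw [integral_const_mul]
  have hcol : ContDiff ℝ 1 fun t : ℝ => F (y, g y + t) := by fun_prop
  have hcolc : HasCompactSupport fun t : ℝ => F (y, g y + t) := by
    refine HasCompactSupport.intro (K := (fun p : V × ℝ => p.2 - g y) '' tsupport F)
      (hc.isCompact.image (by fun_prop)) fun t ht => ?_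
    by_contra hne
    exact ht ⟨_, subset_tsupport _ hne, by simp⟩
  have hder : ∀ t : ℝ, deriv (fun t : ℝ => F (y, g y + t)) t =
      fderiv ℝ F (y, g y + t) (0, 1) := fun t => by
    have h1 : HasDerivAt (fun t : ℝ => (y, g y + t)) ((0 : V), (1 : ℝ)) t :=
      (hasDerivAt_const t y).prodMk ((hasDerivAt_id t).const_add (g y))
    exact ((hF.differentiable one_ne_zero _).hasFDerivAt.comp_hasDerivAt t h1).deriv
  simp_rw [← hder]
  rw [hcolc.integral_Ioi_deriv_eq hcol]
  simp only [add_zero]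
  ring

end Epigraph

/-! ### Graph charts of the boundary -/

/-- The normalized gradient of a defining function of `Ω` is its outward unit normal. -/
theorem isOutwardUnitNormal_of_hasFDerivAt {Ω : Set E3} {q : E3 → ℝ} {x N : E3}
    (hq : HasFDerivAt q (innerSL ℝ N) x) (hqx : q x = 0) (hN : N ≠ 0)
    (hΩ : ∀ᶠ y in 𝓝 x, (y ∈ Ω ↔ q y < 0)) :
    IsOutwardUnitNormal Ω x (‖N‖⁻¹ • N) := by
  have hNpos : 0 < ‖N‖ := norm_pos_iff.2 hN
  refine ⟨by rw [norm_smul, norm_inv, norm_norm, inv_mul_cancel₀ hNpos.ne'], fun ε hε => ?_⟩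
  have ho := hq.isLittleO.def (mul_pos hε hNpos)
  filter_upwards [ho, hΩ] with y hy hyΩ
  rw [hqx, sub_zero, innerSL_apply_apply, Real.norm_eq_abs, abs_le] at hy
  have hin : ⟪y - x, ‖N‖⁻¹ • N⟫_ℝ * ‖N‖ = ⟪N, y - x⟫_ℝ := by
    rw [inner_smul_right, real_inner_comm]; field_simp
  rw [hyΩ]
  refine ⟨fun h => ?_, fun h => ?_⟩
  · have := mul_lt_mul_of_pos_right h hNpos
    rw [hin] at this
    linarith [hy.1]
  · have := mul_lt_mul_of_pos_right h hNpos
    rw [hin] at this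
    linarith [hy.2]

/-- `Φ` and `g` describe `Ω` inside the ball `B(p, r)` as the epigraph of `g` in the linear
coordinates `Φ`. -/
structure IsGraphChart {V : Type*} [NormedAddCommGroup V] [NormedSpace ℝ V] (Ω : Set E3)
    (p : E3) (r : ℝ) (Φ : (V × ℝ) ≃L[ℝ] E3) (g : V → ℝ) : Prop where
  mem_iff : ∀ x ∈ Metric.ball p r, (x ∈ Ω ↔ g (Φ.symm x).1 < (Φ.symm x).2)

theorem HasLipschitzBoundary.exists_isGraphChart {Ω : Set E3} (hΩ : HasLipschitzBoundary Ω)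
    {p : E3} (hp : p ∈ frontier Ω) :
    ∃ (Φ : (EuclideanSpace ℝ (Fin 2) × ℝ) ≃L[ℝ] E3) (K : NNReal)
      (g : EuclideanSpace ℝ (Fin 2) → ℝ) (r : ℝ),
      LipschitzWith K g ∧ 0 < r ∧ IsGraphChart Ω p r Φ g := by
  obtain ⟨A, K, g, r, hg, hr, h⟩ := hΩ p hp
  let Ψ : E3 ≃ₗ[ℝ] (EuclideanSpace ℝ (Fin 2) × ℝ) :=
    { toFun := fun x => (!₂[A x 0, A x 1], A x 2)
      map_add' := fun x y => by
        ext i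
        · fin_cases i <;> simp
        · simp
      map_smul' := fun c x => by
        ext i
        · fin_cases i <;> simp
        · simp
      invFun := fun q => A.symm !₂[q.1 0, q.1 1, q.2]
      left_inv := fun x => by
        rw [LinearIsometryEquiv.symm_apply_eq]
        ext i
        fin_cases i <;> simp
      right_inv := fun q => by
        ext i
        · fin_cases i <;> simp
        · simp }
  exact ⟨Ψ.toContinuousLinearEquiv.symm, K, g, r, hg, hr, ⟨h⟩⟩

namespace IsGraphChart

section

variable {V : Type*} [NormedAddCommGroup V] [NormedSpace ℝ V] {Ω : Set E3} {p : E3} {r : ℝ}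
  {Φ : (V × ℝ) ≃L[ℝ] E3} {g : V → ℝ}

theorem graph_mem_frontier (h : IsGraphChart Ω p r Φ g) {y : V}
    (hy : Φ (y, g y) ∈ Metric.ball p r) : Φ (y, g y) ∈ frontier Ω := by
  refine ⟨?_, fun hi => ?_⟩
  · have hlim : Tendsto (fun t : ℝ => Φ (y, g y + t)) (𝓝[>] 0) (𝓝 (Φ (y, g y))) := by
      have : ContinuousAt (fun t : ℝ => Φ (y, g y + t)) 0 := by fun_prop
      have h0 := this.tendsto
      simp only [add_zero] at h0
      exact h0.mono_left nhdsWithin_le_nhds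
    refine mem_closure_of_tendsto hlim ?_
    filter_upwards [hlim (Metric.isOpen_ball.mem_nhds hy), self_mem_nhdsWithin] with t ht ht0
    rw [h.mem_iff _ ht]
    simpa using ht0
  · have := (h.mem_iff _ hy).1 (interior_subset hi)
    simp at this

/-- The conormal covector `(∇g, -1)` of the graph of `g`, transported to space by `Φ`. -/
noncomputable def conormal (Φ : (V × ℝ) ≃L[ℝ] E3) (g : V → ℝ) (y : V) : E3 →L[ℝ] ℝ :=
  ((fderiv ℝ g y).comp (ContinuousLinearMap.fst ℝ V ℝ) - ContinuousLinearMap.snd ℝ V ℝ).comp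
    (Φ.symm : E3 →L[ℝ] V × ℝ)

theorem conormal_apply (y : V) (v : E3) :
    conormal Φ g y v = fderiv ℝ g y (Φ.symm v).1 - (Φ.symm v).2 := rfl

/-- At a point of differentiability of `g`, every linear relation satisfied by the outward unit
normal is satisfied by the conormal covector. -/
theorem sum_mul_conormal_eq_zero (h : IsGraphChart Ω p r Φ g) {y : V}
    (hy : Φ (y, g y) ∈ Metric.ball p r) (hg : DifferentiableAt ℝ g y) {T : Fin 3 → ℝ}
    (hT : ∀ n : E3, IsOutwardUnitNormal Ω (Φ (y, g y)) n → ∑ i, T i * n i = 0) :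
    ∑ i, T i * conormal Φ g y (EuclideanSpace.single i 1) = 0 := by
  set N : E3 := (InnerProductSpace.toDual ℝ E3).symm (conormal Φ g y) with hNdef
  have hN : innerSL ℝ N = conormal Φ g y := by
    ext v
    simp [hNdef]
  have hN0 : N ≠ 0 := by
    intro h0
    have : conormal Φ g y (Φ (0, 1)) = -1 := by simp [conormal_apply]
    rw [← hN, h0] at this
    simp at this
  have hq : HasFDerivAt (fun x => g (Φ.symm x).1 - (Φ.symm x).2) (innerSL ℝ N)
      (Φ (y, g y)) := by
    rw [hN]
    have hs : HasFDerivAt (fun x => Φ.symm x) (Φ.symm : E3 →L[ℝ] V × ℝ) (Φ (y, g y)) :=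
      Φ.symm.hasFDerivAt
    have hg' : HasFDerivAt g (fderiv ℝ g y) (Φ.symm (Φ (y, g y))).1 := by
      simpa using hg.hasFDerivAt
    exact (hg'.comp (Φ (y, g y)) hs.fst).sub hs.snd
  have hn := isOutwardUnitNormal_of_hasFDerivAt (Ω := Ω) hq (by simp) hN0 (by
    filter_upwards [Metric.isOpen_ball.mem_nhds hy] with x hx
    rw [h.mem_iff x hx, sub_neg])
  have := hT _ hn
  have hcoord : ∀ i, conormal Φ g y (EuclideanSpace.single i 1) = N i := fun i => by
    rw [← hN, innerSL_apply_apply, EuclideanSpace.inner_single_right]; simp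
  have hscale : ∑ i, T i * N i = ‖N‖ * ∑ i, T i * (‖N‖⁻¹ • N) i := by
    rw [Finset.mul_sum]
    refine Finset.sum_congr rfl fun i _ => ?_
    simp only [PiLp.smul_apply, smul_eq_mul]
    field_simp [norm_ne_zero_iff.2 hN0]
  simp_rw [hcoord]
  rw [hscale, this, mul_zero]

theorem measurable_conormal_apply [MeasurableSpace V] [BorelSpace V] [FiniteDimensional ℝ V]
    (v : E3) : Measurable fun y => conormal Φ g y v := by
  simp_rw [conormal_apply]
  exact (measurable_fderiv_apply_const ℝ g _).sub measurable_const

theorem norm_conormal_apply_le {K : NNReal} (hg : LipschitzWith K g) (y : V) (v : E3) :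
    ‖conormal Φ g y v‖ ≤ K * ‖(Φ.symm v).1‖ + ‖(Φ.symm v).2‖ := by
  rw [conormal_apply]
  refine (norm_sub_le _ _).trans (add_le_add ?_ le_rfl)
  exact ((fderiv ℝ g y).le_opNorm _).trans
    (mul_le_mul_of_nonneg_right (norm_fderiv_le_of_lipschitz ℝ hg) (norm_nonneg _))

end

section

variable {V : Type*} [NormedAddCommGroup V] [NormedSpace ℝ V] [FiniteDimensional ℝ V]
  [MeasurableSpace V] [BorelSpace V] {μ : Measure V} [μ.IsAddHaarMeasure] {Ω : Set E3}
  {p : E3} {r : ℝ} {Φ : (V × ℝ) ≃L[ℝ] E3} {g : V → ℝ} {K : NNReal}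

variable (μ) in
/-- The surface measure dominates, up to a constant, the image of Lebesgue measure under the
parametrization of the graph, because the projection back to the base is Lipschitz. -/
theorem exists_map_graph_le (h : IsGraphChart Ω p r Φ g) (hg : Continuous g)
    (hV : Module.finrank ℝ V = 2) :
    ∃ C : ENNReal, C ≠ ⊤ ∧
      (μ.restrict {y | Φ (y, g y) ∈ Metric.ball p r}).map (fun y => Φ (y, g y)) ≤
        C • surfaceMeasure Ω := by
  have hH : (μH[2] : Measure V).IsAddHaarMeasure := by
    have := isAddHaarMeasure_hausdorffMeasure (E := V)
    rwa [hV] at this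
  have hγ : Continuous fun y => Φ (y, g y) := by fun_prop
  let π : E3 →L[ℝ] V := (ContinuousLinearMap.fst ℝ V ℝ).comp (Φ.symm : E3 →L[ℝ] V × ℝ)
  refine ⟨Measure.addHaarScalarFactor μ μH[2] * (‖π‖₊ : ENNReal) ^ (2 : ℝ), ?_, ?_⟩
  · exact ENNReal.mul_ne_top ENNReal.coe_ne_top
      (ENNReal.rpow_ne_top_of_nonneg (by norm_num) ENNReal.coe_ne_top)
  · refine Measure.le_iff.2 fun s hs => ?_
    rw [Measure.map_apply hγ.measurable hs, Measure.restrict_apply (hγ.measurable hs),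
      Measure.smul_apply, surfaceMeasure, Measure.restrict_apply hs, smul_eq_mul, mul_assoc]
    have hsub : (fun y => Φ (y, g y)) ⁻¹' s ∩ {y | Φ (y, g y) ∈ Metric.ball p r} ⊆
        π '' (s ∩ frontier Ω) := fun y hy =>
      ⟨Φ (y, g y), ⟨hy.1, h.graph_mem_frontier hy.2⟩, by simp [π]⟩
    refine (measure_mono hsub).trans ?_
    have hμ : μ (π '' (s ∩ frontier Ω)) =
        Measure.addHaarScalarFactor μ μH[2] * μH[2] (π '' (s ∩ frontier Ω)) := by
      conv_lhs => rw [Measure.isAddLeftInvariant_eq_smul μ (μH[2] : Measure V)]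
      rfl
    rw [hμ]
    gcongr
    exact π.lipschitz.hausdorffMeasure_image_le (by norm_num) _

variable (μ) in
/-- The divergence theorem in a graph chart for a function supported in the chart. The constant
`c` is the Jacobian of the linear coordinates. -/
theorem exists_setIntegral_fderiv_eq (h : IsGraphChart Ω p r Φ g) (hΩ : MeasurableSet Ω)
    (hg : LipschitzWith K g) :
    ∃ c : ℝ, ∀ f : E3 → ℝ, ContDiff ℝ 1 f → HasCompactSupport f →
      tsupport f ⊆ Metric.ball p r → ∀ v : E3,
      ∫ x in Ω, fderiv ℝ f x v = c * ∫ y, f (Φ (y, g y)) * conormal Φ g y v ∂μ := by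
  have hmap : ((μ.prod (volume : Measure ℝ)).map Φ).IsAddHaarMeasure :=
    Φ.toContinuousAddEquiv.isAddHaarMeasure_map _
  refine ⟨(Measure.addHaarScalarFactor (volume : Measure E3) ((μ.prod volume).map Φ) : ℝ),
    fun f hf hc hsupp v => ?_⟩
  have hepi : MeasurableSet {q : V × ℝ | g q.1 < q.2} :=
    (isOpen_lt (hg.continuous.comp continuous_fst) continuous_snd).measurableSet
  let O : Set E3 := {x | g (Φ.symm x).1 < (Φ.symm x).2}
  have hO : MeasurableSet O := Φ.symm.continuous.measurable hepi
  have hzero : ∀ x ∉ Metric.ball p r, fderiv ℝ f x v = 0 := fun x hx => by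
    have : x ∉ tsupport (fderiv ℝ f) := fun hm => hx (hsupp (tsupport_fderiv_subset ℝ hm))
    rw [image_eq_zero_of_notMem_tsupport this]; rfl
  have hΩO : Ω ∩ Metric.ball p r = O ∩ Metric.ball p r := by
    ext x
    exact ⟨fun hx => ⟨(h.mem_iff x hx.2).1 hx.1, hx.2⟩,
      fun hx => ⟨(h.mem_iff x hx.2).2 hx.1, hx.2⟩⟩
  have h1 : ∫ x in Ω, fderiv ℝ f x v = ∫ x in O, fderiv ℝ f x v := by
    have hres : ∀ s : Set E3, MeasurableSet s →
        ∫ x in s, fderiv ℝ f x v = ∫ x in s ∩ Metric.ball p r, fderiv ℝ f x v := fun s hs =>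
      setIntegral_eq_of_subset_of_forall_sdiff_eq_zero hs Set.inter_subset_left
        fun x hx => hzero x fun hxb => hx.2 ⟨hx.1, hxb⟩
    rw [hres Ω hΩ, hres O hO, hΩO]
  have h2 : ∀ φ : E3 → ℝ, ∫ x in O, φ x =
      (Measure.addHaarScalarFactor (volume : Measure E3) ((μ.prod volume).map Φ) : ℝ) *
        ∫ x in O, φ x ∂((μ.prod volume).map Φ) := fun φ => by
    conv_lhs => rw [Measure.isAddLeftInvariant_eq_smul (volume : Measure E3)
      ((μ.prod volume).map Φ)]
    rw [Measure.restrict_smul, integral_smul_nnreal_measure]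
    rfl
  have hpre : Φ ⁻¹' O = {q : V × ℝ | g q.1 < q.2} := by
    ext q; simp [O]
  have hF : ContDiff ℝ 1 (f ∘ Φ) := hf.comp Φ.contDiff
  have hFc : HasCompactSupport (f ∘ Φ) := hc.comp_homeomorph Φ.toHomeomorph
  have hΦ : MeasurableEmbedding Φ := Φ.toHomeomorph.measurableEmbedding
  rw [h1, h2, hΦ.setIntegral_map, hpre]
  have hder : ∀ q, fderiv ℝ f (Φ q) v =
      fderiv ℝ (f ∘ Φ) q ((Φ.symm v).1, (Φ.symm v).2) := fun q => by
    rw [Φ.comp_right_fderiv]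
    simp
  simp_rw [hder]
  rw [integral_fderiv_epigraph hg hF hFc]
  rfl

end
end IsGraphChart

/-! ### Weak derivatives, traces and the Gauss–Green formula -/

theorem IsWeakPartial.ae_eq {Ω : Set E3} (hΩ : IsOpen Ω) {i : Fin 3} {u v v' : E3 → ℝ}
    (h : IsWeakPartial Ω i u v) (h' : IsWeakPartial Ω i u v') :
    v =ᵐ[volume.restrict Ω] v' := by
  have hloc : ∀ {w : E3 → ℝ}, MemLp w 2 (volume.restrict Ω) → LocallyIntegrableOn w Ω := by
    intro w hw
    exact locallyIntegrableOn_of_locallyIntegrable_restrict (hw.locallyIntegrable (by norm_num))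
  have hsub : LocallyIntegrableOn (v - v') Ω := (hloc h.1).sub (hloc h'.1)
  have key := hΩ.ae_eq_zero_of_integral_contDiff_smul_eq_zero hsub fun φ hφ hc hsupp => by
    have hφ2 : MemLp φ 2 (volume.restrict Ω) := hφ.continuous.memLp_of_hasCompactSupport hc
    have e : ∫ x in Ω, v x * φ x = ∫ x in Ω, v' x * φ x :=
      neg_injective ((h.2 φ hφ hc hsupp).symm.trans (h'.2 φ hφ hc hsupp))
    have hz : ∫ x in Ω, φ x • (v - v') x = 0 := by
      have : ∀ x, φ x • (v - v') x = v x * φ x - v' x * φ x := fun x => by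
        simp only [smul_eq_mul, Pi.sub_apply]; ring
      simp_rw [this]
      have i1 : Integrable (fun x => v x * φ x) (volume.restrict Ω) := h.1.integrable_mul hφ2
      have i2 : Integrable (fun x => v' x * φ x) (volume.restrict Ω) := h'.1.integrable_mul hφ2
      rw [integral_sub i1 i2, e, sub_self]
    rw [← hz]
    refine (setIntegral_eq_integral_of_forall_compl_eq_zero fun x hx => ?_).symm
    rw [image_eq_zero_of_notMem_tsupport fun hm => hx (hsupp hm), zero_smul]
  filter_upwards [(ae_restrict_iff' hΩ.measurableSet).2 key] with x hx
  exact sub_eq_zero.1 hx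

theorem IsWeakPartial.congr {Ω : Set E3} {i : Fin 3} {u u' v : E3 → ℝ}
    (h : IsWeakPartial Ω i u v) (hu : u =ᵐ[volume.restrict Ω] u') : IsWeakPartial Ω i u' v := by
  refine ⟨h.1, fun φ hφ hc hsupp => (h.2 φ hφ hc hsupp).symm ▸ integral_congr_ae ?_⟩
  filter_upwards [hu] with x hx
  rw [hx]

theorem IsTrace.congr {Ω : Set E3} {u u' T : E3 → ℝ}
    (h : IsTrace Ω u T) (hu : u =ᵐ[volume.restrict Ω] u') : IsTrace Ω u' T := by
  obtain ⟨hT, Du, w, hD, hw, h0, h1, h2⟩ := h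
  refine ⟨hT, Du, w, fun i => (hD i).congr hu, hw, ?_, h1, h2⟩
  refine h0.congr fun k => eLpNorm_congr_ae ?_
  filter_upwards [hu] with x hx
  rw [hx]

theorem continuous_partialDeriv {f : E3 → ℝ} (hf : ContDiff ℝ 1 f) (i : Fin 3) :
    Continuous (partialDeriv i f) :=
  (hf.continuous_fderiv one_ne_zero).clm_apply continuous_const

theorem contDiff_partialDeriv {f : E3 → ℝ} (hf : ContDiff ℝ ∞ f) (i : Fin 3) :
    ContDiff ℝ ∞ (partialDeriv i f) :=
  (hf.fderiv_right (m := ∞) (by simp)).clm_apply contDiff_const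

theorem hasCompactSupport_partialDeriv {f : E3 → ℝ} (hf : HasCompactSupport f) (i : Fin 3) :
    HasCompactSupport (partialDeriv i f) :=
  hf.fderiv_apply ℝ _

theorem partialDeriv_mul {f h : E3 → ℝ} (hf : ContDiff ℝ 1 f) (hh : ContDiff ℝ 1 h) (i : Fin 3)
    (x : E3) : partialDeriv i (fun x => f x * h x) x =
      partialDeriv i f x * h x + f x * partialDeriv i h x := by
  unfold partialDeriv
  rw [fderiv_fun_mul (hf.differentiable one_ne_zero x) (hh.differentiable one_ne_zero x)]
  simp only [add_apply, smul_apply, smul_eq_mul]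
  ring

/-- The Gauss–Green formula for a trace in a graph chart, tested against a function supported in
the chart. It follows from the formula for the smooth approximations that define the trace. The
constant `c` is the Jacobian of the linear coordinates. -/
theorem IsGraphChart.exists_gaussGreen {V : Type*} [NormedAddCommGroup V] [NormedSpace ℝ V]
    [FiniteDimensional ℝ V] [MeasurableSpace V] [BorelSpace V] (μ : Measure V)
    [μ.IsAddHaarMeasure] (hV : Module.finrank ℝ V = 2) {Ω : Set E3} {p : E3} {r : ℝ}
    {Φ : (V × ℝ) ≃L[ℝ] E3} {g : V → ℝ} {K : NNReal} (h : IsGraphChart Ω p r Φ g)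
    (hΩ : IsOpen Ω) (hg : LipschitzWith K g) :
    ∃ c : ℝ, ∀ {u T D : E3 → ℝ} {i : Fin 3}, MemLp u 2 (volume.restrict Ω) → IsTrace Ω u T →
      IsWeakPartial Ω i u D → ∀ φ : E3 → ℝ, ContDiff ℝ ∞ φ → HasCompactSupport φ →
      tsupport φ ⊆ Metric.ball p r →
      Integrable (fun y => T (Φ (y, g y)) *
        (φ (Φ (y, g y)) * conormal Φ g y (EuclideanSpace.single i 1)))
        (μ.restrict {y | Φ (y, g y) ∈ Metric.ball p r}) ∧
      (∫ x in Ω, D x * φ x) + ∫ x in Ω, u x * partialDeriv i φ x =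
        c * ∫ y in {y | Φ (y, g y) ∈ Metric.ball p r}, T (Φ (y, g y)) *
          (φ (Φ (y, g y)) * conormal Φ g y (EuclideanSpace.single i 1)) ∂μ := by
  obtain ⟨c, hc⟩ := h.exists_setIntegral_fderiv_eq μ hΩ.measurableSet hg
  obtain ⟨C, hCtop, hC⟩ := h.exists_map_graph_le μ hg.continuous hV
  refine ⟨c, fun {u T D i} hu hT hD φ hφ hφc hφs => ?_⟩
  obtain ⟨hT2, Du, w, hDu, hw, hw0, hw1, hwT⟩ := hT
  have hDD := (hDu i).ae_eq hΩ hD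
  set γ : V → E3 := fun y => Φ (y, g y) with hγdef
  have hγ : Continuous γ := Φ.continuous.comp (continuous_id.prodMk hg.continuous)
  set U : Set V := {y | γ y ∈ Metric.ball p r} with hU
  have hφ1 : ContDiff ℝ 1 φ := hφ.of_le (by norm_cast)
  have hw' : ∀ k, ContDiff ℝ 1 (w k) := fun k => (hw k).of_le (by norm_cast)
  -- convergence of the volume integrals
  have hvol : Tendsto (fun k => ∫ x in Ω, fderiv ℝ (fun x => w k x * φ x) x
      (EuclideanSpace.single i 1)) atTop
      (𝓝 ((∫ x in Ω, Du i x * φ x) + ∫ x in Ω, u x * partialDeriv i φ x)) := by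
    have t1 := tendsto_integral_mul_of_tendsto_eLpNorm_sub (hDu i).1
      (fun k => (continuous_partialDeriv (hw' k) i).aestronglyMeasurable) (hw1 i)
      (hφ.continuous.memLp_of_hasCompactSupport hφc)
    have t2 := tendsto_integral_mul_of_tendsto_eLpNorm_sub hu
      (fun k => (hw k).continuous.aestronglyMeasurable) hw0
      ((continuous_partialDeriv hφ1 i).memLp_of_hasCompactSupport
        (hasCompactSupport_partialDeriv hφc i))
    refine (t1.add t2).congr fun k => ?_
    rw [← integral_add]
    · refine integral_congr_ae (Eventually.of_forall fun x => ?_)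
      exact (partialDeriv_mul (hw' k) hφ1 i x).symm
    · exact (((continuous_partialDeriv (hw' k) i).mul
        hφ.continuous).integrable_of_hasCompactSupport hφc.mul_left).integrableOn
    · exact (((hw k).continuous.mul
        (continuous_partialDeriv hφ1 i)).integrable_of_hasCompactSupport
        (hasCompactSupport_partialDeriv hφc i).mul_left).integrableOn
  -- convergence of the boundary integrals, by comparison with the surface measure
  have hfin : IsFiniteMeasure (μ.restrict U) := by
    refine ⟨?_⟩
    rw [Measure.restrict_apply_univ]
    have hK : IsCompact ((fun x => (Φ.symm x).1) '' Metric.closedBall p r) :=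
      (isCompact_closedBall p r).image (by fun_prop)
    refine (measure_mono fun y hy => ?_).trans_lt (hK.measure_lt_top (μ := μ))
    exact ⟨γ y, Metric.ball_subset_closedBall hy, by simp [γ]⟩
  have hTγ : MemLp (fun y => T (γ y)) 2 (μ.restrict U) :=
    (hT2.of_measure_le_smul hCtop hC).comp_of_map hγ.aemeasurable
  have hmeasT : ∀ k, AEStronglyMeasurable (fun x => w k x - T x)
      ((μ.restrict U).map γ) := fun k =>
    (hw k).continuous.aestronglyMeasurable.sub (hT2.of_measure_le_smul hCtop hC).1
  have hwγ : Tendsto (fun k => eLpNorm (fun y => w k (γ y) - T (γ y)) 2 (μ.restrict U)) atTop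
      (𝓝 0) := by
    have hbound : Tendsto (fun k => C ^ (1 / (2 : ENNReal)).toReal •
        eLpNorm (fun x => w k x - T x) 2 (surfaceMeasure Ω)) atTop (𝓝 0) := by
      have := ENNReal.Tendsto.const_mul (a := C ^ (1 / (2 : ENNReal)).toReal) hwT
        (Or.inr (ENNReal.rpow_ne_top_of_nonneg (by positivity) hCtop))
      simpa using this
    refine tendsto_of_tendsto_of_tendsto_of_le_of_le tendsto_const_nhds hbound
      (fun _ => zero_le) fun k => ?_
    have e := eLpNorm_map_measure (p := 2) (hmeasT k) hγ.aemeasurable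
    refine (e.symm.le.trans (eLpNorm_mono_measure _ hC)).trans ?_
    rw [eLpNorm_smul_measure_of_ne_top (by norm_num)]
  obtain ⟨B, hB⟩ := hφc.exists_bound_of_continuous hφ.continuous
  have hψ : MemLp (fun y => φ (γ y) * conormal Φ g y (EuclideanSpace.single i 1)) 2
      (μ.restrict U) := by
    refine MemLp.of_bound (((hφ.continuous.comp hγ).measurable.mul
      (measurable_conormal_apply _)).aestronglyMeasurable) (B * _) (Eventually.of_forall fun y =>
        (norm_mul_le _ _).trans (mul_le_mul (hB _) (norm_conormal_apply_le hg y _)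
          (norm_nonneg _) ((norm_nonneg _).trans (hB 0))))
  have hbd := tendsto_integral_mul_of_tendsto_eLpNorm_sub hTγ
    (fun k => ((hw k).continuous.comp hγ).aestronglyMeasurable) hwγ hψ
  refine ⟨hTγ.integrable_mul hψ, ?_⟩
  have hD' : ∫ x in Ω, D x * φ x = ∫ x in Ω, Du i x * φ x := by
    refine integral_congr_ae ?_
    filter_upwards [hDD] with x hx
    rw [hx]
  rw [hD']
  refine tendsto_nhds_unique hvol ((hbd.const_mul c).congr fun k => ?_)
  rw [hc _ ((hw' k).mul hφ1) hφc.mul_left ((tsupport_mul_subset_right).trans hφs)]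
  congr 1
  rw [setIntegral_eq_integral_of_forall_compl_eq_zero]
  · refine integral_congr_ae (Eventually.of_forall fun y => ?_)
    simp only [Function.comp_apply, γ]
    ring
  · intro y hy
    rw [image_eq_zero_of_notMem_tsupport (f := φ) fun hm => hy (hφs hm)]
    simp

/-! ### Divergence-free fields with zero normal trace -/

theorem sum_integral_mul_eq_zero {α : Type*} [MeasurableSpace α] {μ : Measure α}
    {D : Fin 3 → α → ℝ} {φ : α → ℝ} (hD : ∀ i, MemLp (D i) 2 μ) (hφ : MemLp φ 2 μ)
    (hsum : ∀ᵐ x ∂μ, ∑ i, D i x = 0) : ∑ i, ∫ x, D i x * φ x ∂μ = 0 := by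
  have hi : ∀ i, Integrable (fun x => D i x * φ x) μ := fun i => (hD i).integrable_mul hφ
  rw [← integral_finsetSum _ fun i _ => hi i]
  refine integral_eq_zero_of_ae ?_
  filter_upwards [hsum] with x hx
  simp only [Pi.zero_apply]
  rw [← Finset.sum_mul, hx, zero_mul]

/-- Near every point of space, a divergence-free `H¹` vector field with zero normal trace is
divergence-free after extension by zero. -/
theorem exists_ball_sum_integral_mul_partialDeriv_eq_zero {Ω : Set E3} (hΩ : IsOpen Ω)
    (hlip : HasLipschitzBoundary Ω) {u T D : Fin 3 → E3 → ℝ}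
    (hu : ∀ i, MemLp (u i) 2 (volume.restrict Ω)) (hD : ∀ i, IsWeakPartial Ω i (u i) (D i))
    (hsum : ∀ᵐ x ∂(volume.restrict Ω), ∑ i, D i x = 0) (hT : ∀ i, IsTrace Ω (u i) (T i))
    (hn : ∀ᵐ x ∂(surfaceMeasure Ω), ∀ n : E3, IsOutwardUnitNormal Ω x n →
      ∑ i, T i x * n i = 0) (p : E3) :
    ∃ r > 0, ∀ φ : E3 → ℝ, ContDiff ℝ ∞ φ → HasCompactSupport φ →
      tsupport φ ⊆ Metric.ball p r → ∑ i, ∫ x in Ω, u i x * partialDeriv i φ x = 0 := by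
  have hDφ : ∀ φ : E3 → ℝ, ContDiff ℝ ∞ φ → HasCompactSupport φ →
      ∑ i, ∫ x in Ω, D i x * φ x = 0 := fun φ hφ hφc =>
    sum_integral_mul_eq_zero (fun i => (hD i).1)
      (hφ.continuous.memLp_of_hasCompactSupport hφc) hsum
  by_cases hpc : p ∈ closure Ω
  · by_cases hpΩ : p ∈ Ω
    · obtain ⟨r, hr, hball⟩ := Metric.isOpen_iff.1 hΩ p hpΩ
      refine ⟨r, hr, fun φ hφ hφc hs => ?_⟩
      simp_rw [fun i => (hD i).2 φ hφ hφc (hs.trans hball)]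
      rw [Finset.sum_neg_distrib, hDφ φ hφ hφc, neg_zero]
    · have hpf : p ∈ frontier Ω := ⟨hpc, fun hi => hpΩ (interior_subset hi)⟩
      obtain ⟨Φ, K, g, r, hg, hr, h⟩ := hlip.exists_isGraphChart hpf
      have hV : Module.finrank ℝ (EuclideanSpace ℝ (Fin 2)) = 2 := by simp
      obtain ⟨c, hc⟩ := h.exists_gaussGreen volume hV hΩ hg
      obtain ⟨C, -, hC⟩ := h.exists_map_graph_le volume hg.continuous hV
      refine ⟨r, hr, fun φ hφ hφc hs => ?_⟩
      have hGG := fun i => hc (hu i) (hT i) (hD i) φ hφ hφc hs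
      have hγ : Continuous fun y => Φ (y, g y) :=
        Φ.continuous.comp (continuous_id.prodMk hg.continuous)
      have hac := (Measure.absolutelyContinuous_of_le_smul hC).ae_le hn
      have hnγ := ae_of_ae_map hγ.aemeasurable hac
      have hU : MeasurableSet {y | Φ (y, g y) ∈ Metric.ball p r} :=
        (Metric.isOpen_ball.preimage hγ).measurableSet
      have hz : ∑ i, ∫ y in {y | Φ (y, g y) ∈ Metric.ball p r}, T i (Φ (y, g y)) *
          (φ (Φ (y, g y)) * IsGraphChart.conormal Φ g y (EuclideanSpace.single i 1)) = 0 := by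
        rw [← integral_finsetSum _ fun i _ => (hGG i).1]
        refine integral_eq_zero_of_ae ?_
        filter_upwards [hnγ, ae_restrict_mem hU,
          ae_restrict_of_ae (hg.ae_differentiableAt (μ := volume))] with y hy hyU hyd
        have := h.sum_mul_conormal_eq_zero hyU hyd hy
        simp only [Pi.zero_apply]
        calc _ = φ (Φ (y, g y)) * ∑ i, T i (Φ (y, g y)) *
              IsGraphChart.conormal Φ g y (EuclideanSpace.single i 1) := by
              rw [Finset.mul_sum]
              exact Finset.sum_congr rfl fun i _ => by ring
          _ = 0 := by rw [this, mul_zero]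
      have hs := Finset.sum_congr (rfl : Finset.univ = Finset.univ) fun i _ => (hGG i).2
      rw [Finset.sum_add_distrib, hDφ φ hφ hφc, zero_add, ← Finset.mul_sum, hz, mul_zero] at hs
      exact hs
  · obtain ⟨r, hr, hball⟩ := Metric.isOpen_iff.1 isClosed_closure.isOpen_compl p hpc
    refine ⟨r, hr, fun φ hφ hφc hs => Finset.sum_eq_zero fun i _ => ?_⟩
    refine setIntegral_eq_zero_of_forall_eq_zero fun x hx => ?_
    have hx' : x ∉ tsupport (fderiv ℝ φ) := fun hm =>
      hball (hs (tsupport_fderiv_subset ℝ hm)) (subset_closure hx)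
    simp [partialDeriv, image_eq_zero_of_notMem_tsupport hx']

/-- Localization by a smooth partition of unity on the support of the test function. -/
theorem sum_integral_mul_partialDeriv_eq_zero_of_local {Ω : Set E3} {u : Fin 3 → E3 → ℝ}
    (hu : ∀ i, MemLp (u i) 2 (volume.restrict Ω))
    (hloc : ∀ p : E3, ∃ r > 0, ∀ φ : E3 → ℝ, ContDiff ℝ ∞ φ → HasCompactSupport φ →
      tsupport φ ⊆ Metric.ball p r → ∑ i, ∫ x in Ω, u i x * partialDeriv i φ x = 0)
    {φ : E3 → ℝ} (hφ : ContDiff ℝ ∞ φ) (hφc : HasCompactSupport φ) :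
    ∑ i, ∫ x in Ω, u i x * partialDeriv i φ x = 0 := by
  choose r hr hloc using hloc
  obtain ⟨ρ, hρ⟩ := SmoothPartitionOfUnity.exists_isSubordinate (modelWithCornersSelf ℝ E3)
    (isClosed_tsupport φ) (fun p => Metric.ball p (r p)) (fun p => Metric.isOpen_ball)
    (fun p _ => Set.mem_iUnion.2 ⟨p, Metric.mem_ball_self (hr p)⟩)
  have hfin := ρ.locallyFinite.finite_nonempty_inter_compact hφc.isCompact
  have hψ : ∀ p, ContDiff ℝ ∞ (fun x => ρ p x * φ x) := fun p =>
    (ρ p).contMDiff.contDiff.mul hφ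
  have hψc : ∀ p, HasCompactSupport (fun x => ρ p x * φ x) := fun p => hφc.mul_left
  have hdec : φ = fun x => ∑ p ∈ hfin.toFinset, ρ p x * φ x := by
    ext x
    by_cases hx : x ∈ tsupport φ
    · -- on the support of `φ` the partition sums to one
      rw [← Finset.sum_mul, ρ.sum_finsupport' x hx, one_mul]
      intro p hp
      rw [ρ.mem_finsupport] at hp
      exact hfin.mem_toFinset.2 ⟨x, hp, hx⟩
    · simp [image_eq_zero_of_notMem_tsupport hx]
  have hder : ∀ i x, partialDeriv i φ x =
      ∑ p ∈ hfin.toFinset, partialDeriv i (fun x => ρ p x * φ x) x := fun i x => by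
    conv_lhs => rw [hdec]
    unfold partialDeriv
    rw [fderiv_fun_sum fun p _ => (hψ p).differentiable (by simp) x]
    simp
  have hi : ∀ i p, Integrable (fun x => u i x * partialDeriv i (fun x => ρ p x * φ x) x)
      (volume.restrict Ω) := fun i p => by
    have hp : MemLp (partialDeriv i fun x => ρ p x * φ x) 2 (volume.restrict Ω) :=
      (contDiff_partialDeriv (hψ p) i).continuous.memLp_of_hasCompactSupport
        (hasCompactSupport_partialDeriv (hψc p) i)
    exact (hu i).integrable_mul hp
  simp_rw [hder, Finset.mul_sum]
  simp_rw [fun i => integral_finsetSum hfin.toFinset fun p _ => hi i p]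
  rw [Finset.sum_comm]
  exact Finset.sum_eq_zero fun p _ =>
    hloc p _ (hψ p) (hψc p) ((tsupport_mul_subset_left).trans (hρ p))

/-- A divergence-free `H¹` vector field with zero normal trace is orthogonal to all gradients:
its extension by zero is divergence-free in the whole space. -/
theorem sum_integral_mul_partialDeriv_eq_zero {Ω : Set E3} (hΩ : IsOpen Ω)
    (hbdd : Bornology.IsBounded Ω) (hlip : HasLipschitzBoundary Ω) {u T D : Fin 3 → E3 → ℝ}
    (hu : ∀ i, MemLp (u i) 2 (volume.restrict Ω)) (hD : ∀ i, IsWeakPartial Ω i (u i) (D i))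
    (hsum : ∀ᵐ x ∂(volume.restrict Ω), ∑ i, D i x = 0) (hT : ∀ i, IsTrace Ω (u i) (T i))
    (hn : ∀ᵐ x ∂(surfaceMeasure Ω), ∀ n : E3, IsOutwardUnitNormal Ω x n →
      ∑ i, T i x * n i = 0) {φ : E3 → ℝ} (hφ : ContDiff ℝ ∞ φ) :
    ∑ i, ∫ x in Ω, u i x * partialDeriv i φ x = 0 := by
  -- As `Ω` is bounded, a cutoff equal to `1` near `Ω` reduces to compactly supported `φ`.
  obtain ⟨R, hR, hΩR⟩ := hbdd.subset_ball_lt 0 0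
  let χ : ContDiffBump (0 : E3) := ⟨R, R + 1, hR, by linarith⟩
  have hχ : ContDiff ℝ ∞ (fun x => χ x * φ x) := χ.contDiff.mul hφ
  rw [← sum_integral_mul_partialDeriv_eq_zero_of_local hu
    (exists_ball_sum_integral_mul_partialDeriv_eq_zero hΩ hlip hu hD hsum hT hn) hχ
    χ.hasCompactSupport.mul_right]
  refine Finset.sum_congr rfl fun i _ => setIntegral_congr_fun hΩ.measurableSet fun x hx => ?_
  have hev : (fun x => χ x * φ x) =ᶠ[𝓝 x] φ := by
    filter_upwards [Metric.isOpen_ball.mem_nhds (hΩR hx)] with y hy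
    rw [χ.one_of_mem_closedBall (Metric.ball_subset_closedBall hy), one_mul]
  simp only [partialDeriv, hev.fderiv_eq]

/-! ### Fourier uniqueness and the algebra of stresses without normal components -/

/-- Fourier uniqueness: an integrable function whose sine and cosine transforms vanish on a dense
set of frequencies is zero. The positive and the negative part define finite measures with the
same characteristic function. -/
theorem ae_eq_zero_of_integral_cos_sin_eq_zero {E : Type*} [NormedAddCommGroup E]
    [InnerProductSpace ℝ E] [FiniteDimensional ℝ E] [MeasurableSpace E] [BorelSpace E]
    {μ : Measure E} {f : E → ℝ} (hf : Integrable f μ) {s : Set E} (hs : Dense s)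
    (hcos : ∀ t ∈ s, ∫ x, f x * Real.cos ⟪x, t⟫_ℝ ∂μ = 0)
    (hsin : ∀ t ∈ s, ∫ x, f x * Real.sin ⟪x, t⟫_ℝ ∂μ = 0) : f =ᵐ[μ] 0 := by
  have hp : ∀ {h : E → ℝ}, Integrable h μ →
      IsFiniteMeasure (μ.withDensity fun x => ENNReal.ofReal (h x)) := fun {h} hh =>
    isFiniteMeasure_withDensity_ofReal hh.2
  have hfin₁ := hp hf
  have hfin₂ := hp hf.neg
  have hchar : ∀ {h : E → ℝ}, Integrable h μ → ∀ t,
      charFun (μ.withDensity fun x => ENNReal.ofReal (h x)) t =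
        ∫ x, ((max (h x) 0 : ℝ) : ℂ) * Complex.exp (⟪x, t⟫_ℝ * Complex.I) ∂μ := fun {h} hh t => by
    rw [charFun_apply, integral_withDensity_eq_integral_toReal_smul₀
      hh.aestronglyMeasurable.aemeasurable.ennreal_ofReal
      (Eventually.of_forall fun _ => ENNReal.ofReal_lt_top)]
    simp [ENNReal.toReal_ofReal', Complex.real_smul]
  have hexp : ∀ {h : E → ℝ}, Integrable h μ → ∀ t : E,
      Integrable (fun x => (h x : ℂ) * Complex.exp (⟪x, t⟫_ℝ * Complex.I)) μ := fun {h} hh t => by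
    refine hh.ofReal.mul_bdd (c := 1) ?_ (Eventually.of_forall fun x => ?_)
    · exact Continuous.aestronglyMeasurable (by fun_prop)
    · rw [Complex.norm_exp_ofReal_mul_I]
  have heq : charFun (μ.withDensity fun x => ENNReal.ofReal (f x)) =
      charFun (μ.withDensity fun x => ENNReal.ofReal ((-f) x)) := by
    refine Continuous.ext_on hs continuous_charFun continuous_charFun fun t ht => ?_
    rw [hchar hf, hchar hf.neg, ← sub_eq_zero, ← integral_sub (hexp hf.pos_part t)
      (hexp hf.neg.pos_part t)]
    have hpt : ∀ x, ((max (f x) 0 : ℝ) : ℂ) * Complex.exp (⟪x, t⟫_ℝ * Complex.I) -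
        ((max ((-f) x) 0 : ℝ) : ℂ) * Complex.exp (⟪x, t⟫_ℝ * Complex.I) =
        ((f x * Real.cos ⟪x, t⟫_ℝ : ℝ) : ℂ) +
          ((f x * Real.sin ⟪x, t⟫_ℝ : ℝ) : ℂ) * Complex.I := fun x => by
      have hm : max (f x) 0 - max ((-f) x) 0 = f x := by
        exact max_zero_sub_max_neg_zero_eq_self (f x)
      rw [← sub_mul, ← Complex.ofReal_sub, hm, Complex.exp_mul_I]
      push_cast
      ring
    have hc : Integrable (fun x => f x * Real.cos ⟪x, t⟫_ℝ) μ :=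
      hf.mul_bdd (c := 1) (Continuous.aestronglyMeasurable (by fun_prop))
        (Eventually.of_forall fun x => Real.abs_cos_le_one _)
    have hsn : Integrable (fun x => f x * Real.sin ⟪x, t⟫_ℝ) μ :=
      hf.mul_bdd (c := 1) (Continuous.aestronglyMeasurable (by fun_prop))
        (Eventually.of_forall fun x => Real.abs_sin_le_one _)
    simp_rw [hpt]
    rw [integral_add hc.ofReal (hsn.ofReal.mul_const _), integral_mul_const, integral_complex_ofReal,
      integral_complex_ofReal, hcos t ht, hsin t ht]
    simp
  have hae := (withDensity_eq_iff hf.aestronglyMeasurable.aemeasurable.ennreal_ofReal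
    hf.neg.aestronglyMeasurable.aemeasurable.ennreal_ofReal
    (hf.lintegral_lt_top).ne).1 (Measure.ext_of_charFun heq)
  filter_upwards [hae] with x hx
  rcases le_total (f x) 0 with h | h
  · rw [ENNReal.ofReal_of_nonpos h, eq_comm, ENNReal.ofReal_eq_zero] at hx
    simp only [Pi.neg_apply] at hx
    exact le_antisymm h (neg_nonpos.1 hx)
  · have : ENNReal.ofReal ((-f) x) = 0 := ENNReal.ofReal_of_nonpos (by simpa using h)
    rw [this, ENNReal.ofReal_eq_zero] at hx
    exact le_antisymm hx h

theorem dense_forall_coord_ne_zero : Dense {t : E3 | ∀ i, t i ≠ 0} := by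
  intro t
  let e : E3 := WithLp.toLp 2 fun _ => 1
  have hlim : Tendsto (fun s : ℝ => t + s • e) (𝓝[≠] 0) (𝓝 t) := by
    have : ContinuousAt (fun s : ℝ => t + s • e) 0 := by fun_prop
    have h0 := this.tendsto
    simp only [zero_smul, add_zero] at h0
    exact h0.mono_left nhdsWithin_le_nhds
  refine mem_closure_of_tendsto hlim (eventually_all.2 fun i => ?_)
  by_cases hi : t i = 0
  · filter_upwards [self_mem_nhdsWithin] with s hs
    simpa [hi, e] using hs
  · have : ∀ᶠ y in 𝓝 t, y i ≠ 0 :=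
      (PiLp.continuous_apply 2 (fun _ : Fin 3 => ℝ) i).continuousAt.eventually_ne hi
    exact hlim.eventually this

/-- A nonzero symmetric `3 × 3` matrix with zero diagonal has no vector in its kernel whose
coordinates are all nonzero. -/
theorem eq_zero_of_symm_of_diag_eq_zero {S : Fin 3 → Fin 3 → ℝ} (hS : ∀ i j, S i j = S j i)
    (hd : ∀ i, S i i = 0) {t : Fin 3 → ℝ} (ht : ∀ i, t i ≠ 0)
    (h : ∀ j, ∑ i, S i j * t i = 0) (i j : Fin 3) : S i j = 0 := by
  have h0 := h 0
  have h1 := h 1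
  have h2 := h 2
  simp only [Fin.sum_univ_three, hd, hS 1 0, hS 2 0, hS 2 1, zero_mul, zero_add, add_zero]
    at h0 h1 h2
  have e01 : S 0 1 = 0 := by
    -- Each equation is multiplied by one coordinate; the other two entries cancel.
    have : S 0 1 * (2 * (t 0 * t 1)) = 0 := by linear_combination t 0 * h0 + t 1 * h1 - t 2 * h2
    simpa [ht 0, ht 1] using this
  have e02 : S 0 2 = 0 := by simpa [e01, ht 2] using h0
  have e12 : S 1 2 = 0 := by simpa [e01, ht 2] using h1
  fin_cases i <;> fin_cases j <;> simp [hd, hS 1 0, hS 2 0, hS 2 1, e01, e02, e12]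

theorem partialDeriv_cos_inner (i : Fin 3) (t x : E3) :
    partialDeriv i (fun x => Real.cos ⟪x, t⟫_ℝ) x = -(t i * Real.sin ⟪x, t⟫_ℝ) := by
  have h : HasFDerivAt (fun x : E3 => ⟪x, t⟫_ℝ) (innerSL ℝ t) x := by
    simpa [real_inner_comm] using (innerSL ℝ t).hasFDerivAt (x := x)
  unfold partialDeriv
  rw [h.cos.fderiv]
  simp [EuclideanSpace.inner_single_right, mul_comm]

theorem partialDeriv_sin_inner (i : Fin 3) (t x : E3) :
    partialDeriv i (fun x => Real.sin ⟪x, t⟫_ℝ) x = t i * Real.cos ⟪x, t⟫_ℝ := by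
  have h : HasFDerivAt (fun x : E3 => ⟪x, t⟫_ℝ) (innerSL ℝ t) x := by
    simpa [real_inner_comm] using (innerSL ℝ t).hasFDerivAt (x := x)
  unfold partialDeriv
  rw [h.sin.fderiv]
  simp [EuclideanSpace.inner_single_right, mul_comm]

/-- A symmetric tensor field with zero diagonal that annihilates all gradients vanishes: its
Fourier transform at `t` is a symmetric matrix with zero diagonal and `t` in its kernel. -/
theorem ae_eq_zero_of_sum_integral_mul_partialDeriv_eq_zero {Ω : Set E3}
    (hbdd : Bornology.IsBounded Ω) {σ : E3 → Matrix (Fin 3) (Fin 3) ℝ}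
    (hσ : ∀ i j, MemLp (fun x => σ x i j) 2 (volume.restrict Ω))
    (hsymm : ∀ᵐ x ∂(volume.restrict Ω), (σ x).IsSymm)
    (hdiag : ∀ i, ∀ᵐ x ∂(volume.restrict Ω), σ x i i = 0)
    (hdiv : ∀ j, ∀ φ : E3 → ℝ, ContDiff ℝ ∞ φ →
      ∑ i, ∫ x in Ω, σ x i j * partialDeriv i φ x = 0) :
    ∀ᵐ x ∂(volume.restrict Ω), σ x = 0 := by
  have hfin : IsFiniteMeasure (volume.restrict Ω) :=
    ⟨by rw [Measure.restrict_apply_univ]; exact hbdd.measure_lt_top⟩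
  have hint : ∀ i j, Integrable (fun x => σ x i j) (volume.restrict Ω) := fun i j =>
    (hσ i j).integrable (by norm_num)
  have hzero : ∀ (f : E3 → ℝ) (t : E3), (∀ i, t i ≠ 0) →
      (∀ j, ∑ i, (∫ x in Ω, σ x i j * f x) * t i = 0) → ∀ i j, ∫ x in Ω, σ x i j * f x = 0 := by
    intro f t ht h i j
    refine eq_zero_of_symm_of_diag_eq_zero (S := fun i j => ∫ x in Ω, σ x i j * f x) ?_ ?_ ht h i j
    · refine fun i j => integral_congr_ae ?_
      filter_upwards [hsymm] with x hx
      rw [hx.apply]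
    · refine fun i => integral_eq_zero_of_ae ?_
      filter_upwards [hdiag i] with x hx
      simp [hx]
  have hentry : ∀ i j, ∀ᵐ x ∂(volume.restrict Ω), σ x i j = 0 := fun i j => by
    -- Differentiation exchanges sine and cosine: testing with one gives the equation for the
    -- transform with respect to the other.
    refine ae_eq_zero_of_integral_cos_sin_eq_zero (hint i j) dense_forall_coord_ne_zero
      (fun t ht => hzero _ t ht (fun j => ?_) i j) (fun t ht => hzero _ t ht (fun j => ?_) i j)
    · rw [← hdiv j (fun x => Real.sin ⟪x, t⟫_ℝ)
        (contDiff_id.inner ℝ contDiff_const).sin]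
      refine Finset.sum_congr rfl fun i _ => ?_
      simp_rw [partialDeriv_sin_inner]
      rw [← integral_mul_const]
      exact integral_congr_ae (Eventually.of_forall fun x => by ring)
    · rw [← neg_eq_zero, ← hdiv j (fun x => Real.cos ⟪x, t⟫_ℝ)
        (contDiff_id.inner ℝ contDiff_const).cos,
        ← Finset.sum_neg_distrib]
      refine Finset.sum_congr rfl fun i _ => ?_
      simp_rw [partialDeriv_cos_inner]
      rw [← integral_mul_const, ← integral_neg]
      exact integral_congr_ae (Eventually.of_forall fun x => by ring)
  filter_upwards [ae_all_iff.2 fun i => ae_all_iff.2 (hentry i)] with x hx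
  ext i j
  exact hx i j

theorem Continuous.memLp_restrict_of_isBounded {f : E3 → ℝ} (hf : Continuous f) {Ω : Set E3}
    (hbdd : Bornology.IsBounded Ω) (hΩ : MeasurableSet Ω) : MemLp f 2 (volume.restrict Ω) := by
  have hfin : IsFiniteMeasure (volume.restrict Ω) :=
    ⟨by rw [Measure.restrict_apply_univ]; exact hbdd.measure_lt_top⟩
  obtain ⟨C, hC⟩ := hbdd.isCompact_closure.exists_bound_of_continuousOn hf.continuousOn
  refine MemLp.of_bound hf.aestronglyMeasurable C ?_
  filter_upwards [ae_restrict_mem hΩ] with x hx using hC x (subset_closure hx)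

/-! ### Uniqueness of stresses and strains with given normal components -/

/-- The principle of virtual work: a stress in equilibrium without traction does no work on any
displacement gradient, the displacement being arbitrary at the boundary. -/
theorem DivEqZero.sum_integral_mul_partialDeriv_eq_zero {Ω : Set E3} (hΩ : IsOpen Ω)
    (hbdd : Bornology.IsBounded Ω) (hlip : HasLipschitzBoundary Ω)
    {σ : E3 → Matrix (Fin 3) (Fin 3) ℝ} (hdiv : DivEqZero Ω σ)
    (hσ : ∀ i j, MemLp (fun x => σ x i j) 2 (volume.restrict Ω))
    (hsymm : ∀ᵐ x ∂(volume.restrict Ω), (σ x).IsSymm) (htr : TractionEqZero Ω σ)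
    (j : Fin 3) {φ : E3 → ℝ} (hφ : ContDiff ℝ ∞ φ) :
    ∑ i, ∫ x in Ω, σ x i j * partialDeriv i φ x = 0 := by
  obtain ⟨D, hD, hsum⟩ := hdiv
  obtain ⟨T, hT, hn⟩ := htr
  -- The divergence contracts the first index and the traction the second one, so the trace of the
  -- transposed entry is used.
  refine _root_.sum_integral_mul_partialDeriv_eq_zero hΩ hbdd hlip (u := fun i x => σ x i j)
    (T := fun i x => T x j i) (D := fun i => D i j) (fun i => hσ i j) (fun i => hD i j) ?_
    (fun i => (hT j i).congr ?_) ?_ hφ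
  · filter_upwards [hsum] with x hx using hx j
  · filter_upwards [hsymm] with x hx using hx.apply i j
  · filter_upwards [hn] with x hx n hxn using hx n hxn j

theorem hookeStress_apply (E ν : ℝ) (ε : Matrix (Fin 3) (Fin 3) ℝ) (i j : Fin 3) :
    hookeStress E ν ε i j = E * ν / ((1 + ν) * (1 - 2 * ν)) * (1 : Matrix (Fin 3) (Fin 3) ℝ) i j *
      ε.trace + E / (2 * (1 + ν)) * (ε i j + ε j i) := by
  simp only [hookeStress, isotropicStiffness, Matrix.of_apply, Matrix.trace, Matrix.diag_apply,
    Fin.sum_univ_three]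
  fin_cases i <;> fin_cases j <;> simp [Matrix.one_apply] <;> ring

theorem hookeStress_sub (E ν : ℝ) (ε ε' : Matrix (Fin 3) (Fin 3) ℝ) :
    hookeStress E ν (ε - ε') = hookeStress E ν ε - hookeStress E ν ε' := by
  ext i j
  simp only [hookeStress_apply, Matrix.sub_apply, Matrix.trace_sub]
  ring

theorem isSymm_hookeStress (E ν : ℝ) (ε : Matrix (Fin 3) (Fin 3) ℝ) :
    (hookeStress E ν ε).IsSymm := by
  refine Matrix.IsSymm.ext fun i j => ?_
  rw [hookeStress_apply, hookeStress_apply, Matrix.isSymm_one.apply i j, add_comm (ε j i)]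

/-- Without normal strains the trace term of Hooke's law disappears, and what remains is
multiplication by twice the shear modulus. -/
theorem hookeStress_of_diag_eq_zero {E ν : ℝ} {ε : Matrix (Fin 3) (Fin 3) ℝ} (hε : ε.IsSymm)
    (hd : ∀ i, ε i i = 0) : hookeStress E ν ε = (E / (1 + ν)) • ε := by
  ext i j
  rw [hookeStress_apply, hε.apply i j, Matrix.smul_apply, smul_eq_mul]
  simp only [Matrix.trace, Matrix.diag_apply, hd, Finset.sum_const_zero, mul_zero, zero_add]
  rw [mul_comm 2, ← div_div]
  ring

theorem memLp_hookeStress {E ν : ℝ} {Ω : Set E3} {ε : E3 → Matrix (Fin 3) (Fin 3) ℝ}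
    (hε : ∀ i j, MemLp (fun x => ε x i j) 2 (volume.restrict Ω)) (i j : Fin 3) :
    MemLp (fun x => hookeStress E ν (ε x) i j) 2 (volume.restrict Ω) := by
  simp only [hookeStress, Matrix.of_apply]
  exact memLp_finsetSum _ fun k _ => memLp_finsetSum _ fun l _ => (hε k l).const_mul _

theorem mainTheorem2 (Ω : Set E3) (hΩ_open : IsOpen Ω) (hΩ_bdd : Bornology.IsBounded Ω)
    (hΩ_lip : HasLipschitzBoundary Ω) :
    (∀ σ : E3 → Matrix (Fin 3) (Fin 3) ℝ,
      IsSymmH1 Ω σ → DivEqZero Ω σ → TractionEqZero Ω σ →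
      (∀ i, ∀ᵐ x ∂(volume.restrict Ω), σ x i i = 0) →
      ∀ᵐ x ∂(volume.restrict Ω), σ x = 0) ∧
    (∀ E ν : ℝ, 0 < E → -1 < ν → ν < 1 / 2 →
      ∀ ε ε' : E3 → Matrix (Fin 3) (Fin 3) ℝ,
        IsSymmH1 Ω ε → IsSymmH1 Ω ε' →
        DivEqZero Ω (fun x => hookeStress E ν (ε x)) →
        DivEqZero Ω (fun x => hookeStress E ν (ε' x)) →
        TractionEqZero Ω (fun x => hookeStress E ν (ε x)) →
        TractionEqZero Ω (fun x => hookeStress E ν (ε' x)) →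
        (∀ i, ∀ᵐ x ∂(volume.restrict Ω), ε x i i = ε' x i i) →
        ∀ᵐ x ∂(volume.restrict Ω), ε x = ε' x) := by
  refine ⟨fun σ hσ hdiv htr hdiag => ?_,
    fun E ν hE hν _ ε ε' hε hε' hdiv hdiv' htr htr' hdiag => ?_⟩
  · exact ae_eq_zero_of_sum_integral_mul_partialDeriv_eq_zero hΩ_bdd (fun i j => (hσ.memH1 i j).1)
      hσ.symm hdiag fun j φ hφ => hdiv.sum_integral_mul_partialDeriv_eq_zero hΩ_open hΩ_bdd hΩ_lip
        (fun i j => (hσ.memH1 i j).1) hσ.symm htr j hφ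
  · have hL := fun i j => (hε.memH1 i j).1
    have hL' := fun i j => (hε'.memH1 i j).1
    have hS := memLp_hookeStress (E := E) (ν := ν) hL
    have hS' := memLp_hookeStress (E := E) (ν := ν) hL'
    have hsm := ae_of_all (volume.restrict Ω) fun x => isSymm_hookeStress E ν (ε x)
    have hsm' := ae_of_all (volume.restrict Ω) fun x => isSymm_hookeStress E ν (ε' x)
    have hform : ∀ᵐ x ∂(volume.restrict Ω), hookeStress E ν (ε x) - hookeStress E ν (ε' x) =
        (E / (1 + ν)) • (ε x - ε' x) := by
      filter_upwards [hε.symm, hε'.symm, ae_all_iff.2 hdiag] with x hx hx' hd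
      rw [← hookeStress_sub, hookeStress_of_diag_eq_zero (hx.sub hx')]
      intro i
      rw [Matrix.sub_apply, hd i, sub_self]
    have key := ae_eq_zero_of_sum_integral_mul_partialDeriv_eq_zero hΩ_bdd
      (σ := fun x => hookeStress E ν (ε x) - hookeStress E ν (ε' x))
      (fun i j => (hS i j).sub (hS' i j))
      (by filter_upwards [hsm, hsm'] with x hx hx' using hx.sub hx')
      (fun i => by
        filter_upwards [hform, hdiag i] with x hx hd
        rw [hx, Matrix.smul_apply, Matrix.sub_apply, hd, sub_self, smul_zero])
      (fun j φ hφ => by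
        have hφ2 : ∀ i, MemLp (partialDeriv i φ) 2 (volume.restrict Ω) := fun i =>
          (contDiff_partialDeriv hφ i).continuous.memLp_restrict_of_isBounded hΩ_bdd
            hΩ_open.measurableSet
        have e := hdiv.sum_integral_mul_partialDeriv_eq_zero hΩ_open hΩ_bdd hΩ_lip hS hsm htr j hφ
        have e' := hdiv'.sum_integral_mul_partialDeriv_eq_zero hΩ_open hΩ_bdd hΩ_lip hS' hsm' htr'
          j hφ
        rw [← sub_zero (0 : ℝ)]
        nth_rewrite 1 [← e]
        rw [← e', ← Finset.sum_sub_distrib]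
        refine Finset.sum_congr rfl fun i _ => ?_
        have i1 : Integrable (fun x => hookeStress E ν (ε x) i j * partialDeriv i φ x)
          (volume.restrict Ω) := (hS i j).integrable_mul (hφ2 i)
        have i2 : Integrable (fun x => hookeStress E ν (ε' x) i j * partialDeriv i φ x)
          (volume.restrict Ω) := (hS' i j).integrable_mul (hφ2 i)
        rw [← integral_sub i1 i2]
        simp only [Matrix.sub_apply, sub_mul])
    have hμ : E / (1 + ν) ≠ 0 := (div_pos hE (by linarith)).ne'
    filter_upwards [key, hform] with x hx hx'
    rw [hx'] at hx
    exact sub_eq_zero.1 ((smul_eq_zero.1 hx).resolve_left hμ)
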